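/- Let $\mathbf{x}:\mathbb{R}\to\mathbb{R}^d$ be the $1$-periodic arc-length parametrization ($|\mathbf{x}'|\equiv 1$, $\mathbf{x}(z+1)=\mathbf{x}(z)$) of a non-self-intersecting closed curve of length one and class $C^4$ (so $\mathbf{x}$ is of class $C^4$ on $\mathbb{R}$ and injective on $[0,1)$), and let $s>1$. Write $W(v)=|v|^{-s}/s$ for $v\in\mathbb{R}^d\setminus\{0\}$, $\zeta(s)=\sum_{n\ge 1}n^{-s}$, and, for $\mathbf{Z}=(z_1,\dots,z_N)\in\mathbb{R}^N$, $$E(\mathbf{Z})=N^{-s-1}\sum_{1\le i<j\le N}W(\mathbf{x}(z_i)-\mathbf{x}(z_j)).$$ There is a constant $C>0$, depending only on $s$ and the curve, such that for every $\varepsilon>0$ there is $N_0$, depending only on $\varepsilon$, $s$ and the curve, such that the following holds for all $N>N_0$. If $\mathbf{Z}(t)=(z_1(t),\dots,z_N(t))$, $t\ge 0$, solves $$\dot z_i=-N^{-s}\sum_{j\ne i}\nabla W(\mathbf{x}(z_i)-\mathbf{x}(z_j))\cdot\mathbf{x}'(z_i),\qquad i=1,\dots,N,$$ (that is, $\dot{\mathbf{Z}}=-N\nabla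 E(\mathbf{Z})$) with initial data satisfying $z_1(0)<\cdots<z_N(0)<z_1(0)+1$, then $$E(\mathbf{Z}(t))\le\frac{\zeta(s)}{s}(1+\varepsilon)\qquad\text{for all } t\ge\frac{C}{\varepsilon}.$$ -/

import Mathlib

open scoped Gradient

noncomputable section

namespace RieszFlow

/-- A non-self-intersecting closed `C^4` curve of length one in `ℝ^d`, given by its `1`-periodic
arc-length parametrization `x : ℝ → ℝ^d`. -/
structure IsUnitClosedCurve {d : ℕ} (x : ℝ → EuclideanSpace ℝ (Fin d)) : Prop where
  contDiff : ContDiff ℝ 4 x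
  norm_deriv : ∀ z : ℝ, ‖deriv x z‖ = 1
  periodic : Function.Periodic x 1
  injOn : Set.InjOn x (Set.Ico 0 1)

/-- The Riesz potential `W(v) = |v|^{-s} / s`. -/
def rieszPotential {d : ℕ} (s : ℝ) (v : EuclideanSpace ℝ (Fin d)) : ℝ :=
  ‖v‖ ^ (-s) / s

/-- The normalized Riesz energy
`E(Z) = N^{-s-1} ∑_{i < j} W(x(z_i) - x(z_j))` of the configuration with parameters `Z`. -/
def energy {d N : ℕ} (s : ℝ) (x : ℝ → EuclideanSpace ℝ (Fin d)) (Z : Fin N → ℝ) : ℝ :=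
  (N : ℝ) ^ (-s - 1) * ∑ i : Fin N, ∑ j ∈ Finset.Ioi i, rieszPotential s (x (Z i) - x (Z j))

/-- The velocity of the `i`-th particle,
`-N^{-s} ∑_{j ≠ i} ∇W(x(z_i) - x(z_j)) · x'(z_i)`. -/
def velocity {d N : ℕ} (s : ℝ) (x : ℝ → EuclideanSpace ℝ (Fin d)) (Z : Fin N → ℝ)
    (i : Fin N) : ℝ :=
  -(N : ℝ) ^ (-s) * ∑ j ∈ Finset.univ.erase i,
    inner ℝ (∇ (rieszPotential s) (x (Z i) - x (Z j))) (deriv x (Z i))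

/-- The ordering `z_1 < ⋯ < z_N < z_1 + 1` of the parameters. -/
def IsOrdered {N : ℕ} (Z : Fin N → ℝ) : Prop :=
  StrictMono Z ∧ ∀ i j : Fin N, Z i < Z j + 1

/-- `z` solves the system `ż_i = velocity_i(z)` on `[0, ∞)` (with the one-sided derivative at
time `0`). -/
def IsSolution {d N : ℕ} (s : ℝ) (x : ℝ → EuclideanSpace ℝ (Fin d))
    (z : ℝ → Fin N → ℝ) : Prop :=
  ∀ t : ℝ, 0 ≤ t → ∀ i : Fin N,
    HasDerivWithinAt (fun τ => z τ i) (velocity s x (z t) i) (Set.Ici 0) t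

/-- `ζ(s) = ∑_{n ≥ 1} n^{-s}` for real `s` (used only for `s > 1`, where the series converges). -/
def zeta (s : ℝ) : ℝ := ∑' n : ℕ, ((n : ℝ) + 1) ^ (-s)

end RieszFlow

end

/-!
The flow is `ż = -N ∇E(z)`. If `E` were convex, its gradient flow would satisfy
`E(z(t)) - min E ≤ dist(z(0), Z*)² / (2 N t)`, and `dist(z(0), Z*)² ≤ N` for a suitably placed
equispaced configuration `Z*`, which gives the rate `1 / t` uniformly in `N`. The energy
need not be convex, but the argument only needs convexity along the
segment from `z` to `Z*`, and this holds up to an error that is negligible as `N → ∞`.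

* One pair (`exists_pair_bound`). Let `ρ` be the chord and `h` the arc between two particles. The
  tangential components of the chord at both ends equal `h` up to `O(h³)`, because `x'` is a
  Lipschitz field of unit vectors (`exists_abs_inner_sub_le`). Inserting this into the convexity
  inequality of `r ↦ r ^ (-s) / s` at `r = ρ` (`near_pair_ineq`) gives an error of relative size
  `O(h)`, hence at most `η W` for close pairs; by compactness and injectivity all other pairs
  contribute a bounded error `K`.
* Summation (`exists_star_convexity_bound`). The errors `K` add up to `K N² · N^(-s-1) = K N^(1-s)`,
  which vanishes in the limit because `s > 1`, and the equispaced energy is at most `ζ(s) / s`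
  (`sum_equispaced_le`). This needs displacements from `Z*` of size at most one at all times, so
  `Z*` is made to follow the centre of mass of `z`; as the displacements then sum to zero, the
  motion of `Z*` does not enter the derivative of the squared distance.
* Dynamics (`exists_energy_decay`). The energy decreases, so particles never collide and the
  ordering persists (`IsSolution.isOrdered`). With `u` the displacement, the function
  `|u|² / (2 N) + t ((1 - η) E - ζ(s) / s - K N^(1-s))` is nonincreasing and at most `1 / 2` at
  time zero, which bounds the energy at time `t`.
-/

namespace RieszFlow

/-! ### The pair interaction along the curve -/

theorem hasGradientAt_rieszPotential {d : ℕ} {s : ℝ} (hs : s ≠ 0)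
    {v : EuclideanSpace ℝ (Fin d)} (hv : v ≠ 0) :
    HasGradientAt (rieszPotential s) (-(‖v‖ ^ (-s - 2)) • v) v := by
  have hv' : 0 < ‖v‖ := norm_pos_iff.2 hv
  rw [hasGradientAt_iff_hasFDerivAt]
  have h1 : HasFDerivAt (fun w : EuclideanSpace ℝ (Fin d) => ‖w‖ ^ 2) _ v :=
    (hasStrictFDerivAt_norm_sq v).hasFDerivAt
  have h2 := (h1.rpow_const (p := -s / 2) (Or.inl (by positivity))).mul_const (1 / s)
  have hpow : ∀ (r : ℝ) (w : EuclideanSpace ℝ (Fin d)), (‖w‖ ^ 2) ^ r = ‖w‖ ^ (2 * r) := by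
    intro r w
    rw [Real.rpow_mul (norm_nonneg w)]
    norm_num
  have h3 : (fun w : EuclideanSpace ℝ (Fin d) => (‖w‖ ^ 2) ^ (-s / 2) * (1 / s))
      = rieszPotential s := by
    funext w
    rw [hpow, rieszPotential, mul_one_div]
    congr 2
    ring
  rw [h3] at h2
  refine h2.congr_fderiv ?_
  ext w
  simp only [hpow, smul_apply, InnerProductSpace.toDual_apply_apply,
    smul_eq_mul, innerSL_apply_apply, inner_smul_left, nsmul_eq_mul]
  rw [show 2 * (-s / 2 - 1) = -s - 2 by ring]
  simp
  field_simp

/-- The partial derivative `∂_a W(x(a) - x(b))` of the interaction energy of two particles. -/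
noncomputable def pairGrad {d : ℕ} (s : ℝ) (x : ℝ → EuclideanSpace ℝ (Fin d)) (a b : ℝ) : ℝ :=
  inner ℝ (∇ (rieszPotential s) (x a - x b)) (deriv x a)

theorem gradient_rieszPotential {d : ℕ} {s : ℝ} (hs : s ≠ 0)
    {v : EuclideanSpace ℝ (Fin d)} (hv : v ≠ 0) :
    ∇ (rieszPotential s) v = -(‖v‖ ^ (-s - 2)) • v :=
  (hasGradientAt_rieszPotential hs hv).gradient

theorem pairGrad_eq {d : ℕ} {s : ℝ} (hs : s ≠ 0) {x : ℝ → EuclideanSpace ℝ (Fin d)} {a b : ℝ}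
    (h : x a ≠ x b) :
    pairGrad s x a b = ‖x b - x a‖ ^ (-s - 2) * inner ℝ (x b - x a) (deriv x a) := by
  rw [pairGrad, gradient_rieszPotential hs (sub_ne_zero.2 h), inner_smul_left, norm_sub_rev,
    ← neg_sub (x b), inner_neg_left]
  simp

namespace IsUnitClosedCurve

variable {d : ℕ} {x : ℝ → EuclideanSpace ℝ (Fin d)}

theorem hasDerivAt (hx : IsUnitClosedCurve x) (a : ℝ) : HasDerivAt x (deriv x a) a :=
  (hx.contDiff.differentiable (by norm_num) a).hasDerivAt

theorem periodic_deriv (hx : IsUnitClosedCurve x) : Function.Periodic (deriv x) 1 := by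
  intro a
  rw [← deriv_comp_add_const]
  congr 1
  funext b
  exact hx.periodic b

theorem apply_ne (hx : IsUnitClosedCurve x) {a b : ℝ} (h0 : 0 < b - a) (h1 : b - a < 1) :
    x a ≠ x b := by
  intro h
  have hf : ∀ c : ℝ, x (Int.fract c) = x c := fun c => by
    have := hx.periodic.sub_zsmul_eq ⌊c⌋ (x := c)
    rwa [zsmul_one] at this
  have hmem : ∀ c : ℝ, Int.fract c ∈ Set.Ico (0 : ℝ) 1 := fun c =>
    ⟨Int.fract_nonneg c, Int.fract_lt_one c⟩
  have := hx.injOn (hmem b) (hmem a) (by rw [hf, hf, h])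
  obtain ⟨k, hk⟩ := Int.fract_eq_fract.1 this
  rw [hk] at h0 h1
  have h0' : (0 : ℤ) < k := by exact_mod_cast h0
  have h1' : k < (1 : ℤ) := by exact_mod_cast h1
  omega

theorem dist_le (hx : IsUnitClosedCurve x) (a b : ℝ) : ‖x b - x a‖ ≤ |b - a| := by
  have := convex_univ.norm_image_sub_le_of_norm_hasDerivWithin_le (f := x) (f' := deriv x) (C := 1)
    (fun y _ => (hx.hasDerivAt y).hasDerivWithinAt) (fun y _ => (hx.norm_deriv y).le)
    (Set.mem_univ a) (Set.mem_univ b)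
  simpa using this

theorem exists_lipschitz_deriv (hx : IsUnitClosedCurve x) :
    ∃ L : ℝ, ∀ a b : ℝ, ‖deriv x b - deriv x a‖ ≤ L * |b - a| := by
  have hd : ContDiff ℝ 1 (deriv x) :=
    ((contDiff_succ_iff_deriv (n := 1)).1
      (hx.contDiff.of_le (by norm_num))).2.2
  have hper : Function.Periodic (deriv (deriv x)) 1 := by
    intro a
    rw [← deriv_comp_add_const]
    congr 1
    funext b
    exact hx.periodic_deriv b
  obtain ⟨L, hL⟩ := isCompact_Icc.exists_bound_of_continuousOn (s := Set.Icc (0 : ℝ) 1)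
    (hd.continuous_deriv le_rfl).continuousOn
  refine ⟨L, fun a b => ?_⟩
  have := convex_univ.norm_image_sub_le_of_norm_hasDerivWithin_le (f := deriv x)
    (f' := deriv (deriv x)) (C := L)
    (fun y _ => (hd.differentiable (by norm_num) y).hasDerivAt.hasDerivWithinAt) (fun y _ => ?_)
    (Set.mem_univ a) (Set.mem_univ b)
  · simpa using this
  · obtain ⟨y', hy', h⟩ := hper.exists_mem_Ico₀ one_pos y
    rw [h]
    exact hL y' ⟨hy'.1, hy'.2.le⟩

/-- The tangential component of a chord is the arc length up to a *cubic* error: the vectors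
`x'(τ)` have unit length, hence `⟪x'(τ), x'(a)⟫ = 1 - |x'(τ) - x'(a)|² / 2`. -/
theorem exists_abs_inner_sub_le (hx : IsUnitClosedCurve x) :
    ∃ K : ℝ, 0 < K ∧ ∀ a b : ℝ,
      |inner ℝ (x b - x a) (deriv x a) - (b - a)| ≤ K * |b - a| ^ 3 := by
  obtain ⟨L, hL⟩ := hx.exists_lipschitz_deriv
  refine ⟨L ^ 2 / 2 + 1, by positivity, fun a b => ?_⟩
  have hder : ∀ y : ℝ, HasDerivAt (fun τ => inner ℝ (x τ - x a) (deriv x a) - (τ - a))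
      (inner ℝ (deriv x y) (deriv x a) - 1) y := by
    intro y
    have h1 := ((hx.hasDerivAt y).sub_const (x a)).inner ℝ (hasDerivAt_const y (deriv x a))
    have h2 := h1.fun_sub ((hasDerivAt_id y).sub_const a)
    simpa using h2
  have hbd : ∀ y ∈ Set.uIcc a b,
      ‖inner ℝ (deriv x y) (deriv x a) - (1 : ℝ)‖ ≤ (L ^ 2 / 2 + 1) * |b - a| ^ 2 := by
    intro y hy
    have h1 : ‖deriv x y - deriv x a‖ ^ 2 = 2 - 2 * inner ℝ (deriv x y) (deriv x a) := by
      rw [norm_sub_sq_real, hx.norm_deriv, hx.norm_deriv]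
      ring
    have h2 : |y - a| ≤ |b - a| := Set.abs_sub_left_of_mem_uIcc hy
    have h3 : ‖deriv x y - deriv x a‖ ^ 2 ≤ L ^ 2 * |b - a| ^ 2 := by
      calc ‖deriv x y - deriv x a‖ ^ 2 ≤ (L * |y - a|) ^ 2 :=
            pow_le_pow_left₀ (norm_nonneg _) (hL a y) 2
        _ = L ^ 2 * |y - a| ^ 2 := by ring
        _ ≤ L ^ 2 * |b - a| ^ 2 := by gcongr
    have h4 := sq_nonneg ‖deriv x y - deriv x a‖
    have h5 := sq_nonneg |b - a|
    rw [Real.norm_eq_abs, abs_le]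
    constructor <;> nlinarith
  have := (convex_uIcc a b).norm_image_sub_le_of_norm_hasDerivWithin_le
    (fun y _ => (hder y).hasDerivWithinAt) hbd Set.left_mem_uIcc Set.right_mem_uIcc
  simp only [sub_self, inner_zero_left, sub_zero, Real.norm_eq_abs] at this
  calc _ ≤ _ := this
    _ = _ := by ring

theorem exists_chord_lower_bound (hx : IsUnitClosedCurve x) {h₀ : ℝ} (hh : 0 < h₀) :
    ∃ c : ℝ, 0 < c ∧ ∀ a b : ℝ, h₀ ≤ b - a → b - a ≤ 1 / 2 → c ≤ ‖x b - x a‖ := by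
  have hc := hx.contDiff.continuous
  have hcomp : IsCompact (Set.Icc (0 : ℝ) 1 ×ˢ Set.Icc h₀ (1 / 2)) :=
    isCompact_Icc.prod isCompact_Icc
  obtain ⟨c, hc0, hc⟩ := hcomp.exists_forall_le' (f := fun p : ℝ × ℝ => ‖x (p.1 + p.2) - x p.1‖)
    (by fun_prop) (a := 0) (by
      rintro ⟨a, h⟩ ⟨-, h1, h2⟩
      have h1' : h₀ ≤ h := h1
      have h2' : h ≤ 1 / 2 := h2
      exact norm_pos_iff.2 (sub_ne_zero.2
        (hx.apply_ne (a := a) (b := a + h) (by linarith) (by linarith)).symm))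
  refine ⟨c, hc0, fun a b h1 h2 => ?_⟩
  have hper : Function.Periodic (fun t => ‖x (t + (b - a)) - x t‖) 1 := by
    intro t
    simp only
    rw [hx.periodic t, add_right_comm, hx.periodic]
  obtain ⟨t, ht, hta⟩ := hper.exists_mem_Ico₀ one_pos a
  simp only [add_sub_cancel] at hta
  rw [hta]
  exact hc (t, b - a) ⟨⟨ht.1, ht.2.le⟩, h1, h2⟩

end IsUnitClosedCurve

/-- The tangent line inequality for the convex function `r ↦ r ^ (-s) / s` on `(0, ∞)`. -/
theorem rpow_neg_div_tangent_le {s r q : ℝ} (hs : 0 < s) (hr : 0 < r) (hq : 0 < q) :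
    r ^ (-s) / s - r ^ (-s - 1) * (q - r) ≤ q ^ (-s) / s := by
  have h1 : 1 - s * (q / r - 1) ≤ (q / r) ^ (-s) := by
    have hqr : 0 < q / r := by positivity
    rw [Real.rpow_def_of_pos hqr]
    have h2 := Real.add_one_le_exp (Real.log (q / r) * -s)
    have h3 := mul_le_mul_of_nonneg_left (Real.log_le_sub_one_of_pos hqr) hs.le
    linarith
  rw [Real.div_rpow hq.le hr.le] at h1
  have h4 : 0 < r ^ (-s) := by positivity
  rw [le_div_iff₀ h4] at h1
  rw [Real.rpow_sub_one hr.ne', le_div_iff₀ hs]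
  calc _ = (1 - s * (q / r - 1)) * r ^ (-s) := by field_simp
    _ ≤ _ := h1

/-- The key inequality for a pair of particles at arc-length distance `h` and chordal distance
`ρ`. Convexity is used at `ρ` rather than at `h`, so that no power of `ρ` has to be compared with a
power of `h`. -/
theorem near_pair_ineq {s ρ h q e A B u v : ℝ} (hs : 0 < s) (hρ : 0 < ρ) (hρh : ρ ≤ h)
    (hh : h ≤ 1 / 2) (hq : 0 < q) (hA : |A - h| ≤ e) (hB : |B - h| ≤ e) (he : h - e ≤ ρ)
    (hu : |u| ≤ 1) (hv : |v| ≤ 1) (huv : v - u = h - q) :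
    ρ ^ (-s) / s - q ^ (-s) / s - ρ ^ (-s - 2) * (3 * e) ≤ ρ ^ (-s - 2) * (A * u - B * v) := by
  have he0 : 0 ≤ e := (abs_nonneg _).trans hA
  have h1 := rpow_neg_div_tangent_le hs hρ hq
  have h2 : ρ ^ (-s - 1) = ρ ^ (-s - 2) * ρ := by
    rw [← Real.rpow_add_one hρ.ne']
    congr 1
    ring
  have h3 : 0 < ρ ^ (-s - 2) := by positivity
  have hAu : |(A - h) * u| ≤ e := by
    rw [abs_mul]
    calc _ ≤ e * 1 := mul_le_mul hA hu (abs_nonneg _) he0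
      _ = e := mul_one e
  have hBv : |(B - h) * v| ≤ e := by
    rw [abs_mul]
    calc _ ≤ e * 1 := mul_le_mul hB hv (abs_nonneg _) he0
      _ = e := mul_one e
  have h4 : ρ * (q - ρ) - 3 * e ≤ A * u - B * v := by
    have h5 : A * u - B * v = (A - h) * u - (B - h) * v - h * (h - q) := by
      rw [← huv]; ring
    have h6 : 0 ≤ (h - ρ) * q := mul_nonneg (by linarith) hq.le
    have h7 : h ^ 2 - ρ ^ 2 ≤ e := by nlinarith
    rw [h5]
    nlinarith [(abs_le.1 hAu).1, (abs_le.1 hBv).2]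
  have h8 := mul_le_mul_of_nonneg_left h4 h3.le
  rw [h2] at h1
  linarith

theorem abs_pairGrad_le {d : ℕ} {s : ℝ} (hs : 0 < s) {x : ℝ → EuclideanSpace ℝ (Fin d)}
    (hx : IsUnitClosedCurve x) {a b : ℝ} (h : x a ≠ x b) :
    |pairGrad s x a b| ≤ ‖x b - x a‖ ^ (-s - 1) := by
  have hpos : 0 < ‖x b - x a‖ := norm_pos_iff.2 (sub_ne_zero.2 h.symm)
  rw [pairGrad_eq hs.ne' h, abs_mul, abs_of_nonneg (by positivity)]
  calc _ ≤ ‖x b - x a‖ ^ (-s - 2) * (‖x b - x a‖ * ‖deriv x a‖) := by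
        gcongr
        exact abs_real_inner_le_norm _ _
    _ = ‖x b - x a‖ ^ (-s - 1) := by
        rw [hx.norm_deriv, mul_one, ← Real.rpow_add_one hpos.ne']
        congr 1
        ring

/-- The pair inequality for particles at arc-length distance at most `1 / 2`: close particles are
governed by `near_pair_ineq`, and all other pairs contribute at most a constant. -/
theorem exists_half_pair_bound {d : ℕ} {s : ℝ} (hs : 0 < s) {x : ℝ → EuclideanSpace ℝ (Fin d)}
    (hx : IsUnitClosedCurve x) {η : ℝ} (hη : 0 < η) :
    ∃ K : ℝ, 0 ≤ K ∧ ∀ a b q u v : ℝ, 0 < b - a → b - a ≤ 1 / 2 → 0 < q → |u| ≤ 1 → |v| ≤ 1 →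
      v - u = b - a - q →
      (1 - η) * rieszPotential s (x b - x a) - q ^ (-s) / s - K
        ≤ pairGrad s x a b * u + pairGrad s x b a * v := by
  obtain ⟨M, hM, hinner⟩ := hx.exists_abs_inner_sub_le
  -- Below this threshold the chord is at least half the arc, and the cubic errors are at most
  -- `η` times the interaction energy.
  set h₀ : ℝ := min (1 / (2 * M)) (η / (12 * M * s)) with hh₀
  have h₀pos : 0 < h₀ := lt_min (by positivity) (by positivity)
  obtain ⟨c, hc, hchord⟩ := hx.exists_chord_lower_bound h₀pos
  refine ⟨c ^ (-s) / s + 2 * c ^ (-s - 1), by positivity, ?_⟩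
  intro a b q u v hab hab2 hq hu hv huv
  have hne := hx.apply_ne hab (by linarith)
  have hρ : 0 < ‖x b - x a‖ := norm_pos_iff.2 (sub_ne_zero.2 hne.symm)
  have hqs : 0 ≤ q ^ (-s) / s := by positivity
  rcases le_or_gt h₀ (b - a) with hfar | hnear
  · have hcρ := hchord a b hfar hab2
    have h1 : ‖x b - x a‖ ^ (-s - 1) ≤ c ^ (-s - 1) :=
      Real.rpow_le_rpow_of_nonpos hc hcρ (by linarith)
    have h2 : ‖x b - x a‖ ^ (-s) ≤ c ^ (-s) :=
      Real.rpow_le_rpow_of_nonpos hc hcρ (by linarith)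
    have h3 : |pairGrad s x a b * u| ≤ c ^ (-s - 1) := by
      rw [abs_mul]
      calc _ ≤ c ^ (-s - 1) * 1 := mul_le_mul ((abs_pairGrad_le hs hx hne).trans h1) hu
            (abs_nonneg _) (by positivity)
        _ = _ := mul_one _
    have h4 : |pairGrad s x b a * v| ≤ c ^ (-s - 1) := by
      have h1' := abs_pairGrad_le hs hx hne.symm
      rw [norm_sub_rev] at h1'
      rw [abs_mul]
      calc _ ≤ c ^ (-s - 1) * 1 := mul_le_mul (h1'.trans h1) hv
            (abs_nonneg _) (by positivity)
        _ = _ := mul_one _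
    have h5 : rieszPotential s (x b - x a) ≤ c ^ (-s) / s := by
      rw [rieszPotential]
      gcongr
    have h6 : 0 ≤ rieszPotential s (x b - x a) := by
      rw [rieszPotential]
      positivity
    nlinarith [(abs_le.1 h3).1, (abs_le.1 h4).1, mul_nonneg hη.le h6]
  · set ρ := ‖x b - x a‖ with hρdef
    set h := b - a with hh
    have hsmall1 : M * h ≤ 1 / 2 := by
      have := hnear.le.trans (min_le_left _ _)
      rw [le_div_iff₀ (by positivity)] at this
      linarith
    have hsmall2 : 12 * M * h * s ≤ η := by
      have := hnear.le.trans (min_le_right _ _)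
      rw [le_div_iff₀ (by positivity)] at this
      linarith
    have hρh : ρ ≤ h := by
      have := hx.dist_le a b
      rwa [abs_of_pos hab] at this
    have hA := hinner a b
    rw [← hh, abs_of_pos hab] at hA
    have hB : |inner ℝ (x b - x a) (deriv x b) - h| ≤ M * h ^ 3 := by
      have := hinner b a
      rw [← neg_sub b a, ← neg_sub (x b), inner_neg_left, abs_neg, ← hh, abs_of_pos hab,
        ← abs_neg] at this
      convert this using 2
      ring
    have hlow : h - M * h ^ 3 ≤ ρ := by
      have h1 := real_inner_le_norm (x b - x a) (deriv x a)
      rw [hx.norm_deriv, mul_one] at h1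
      linarith [(abs_le.1 hA).1]
    have hhalf : h / 2 ≤ ρ := by
      have : M * h ^ 3 ≤ h / 2 := by
        calc M * h ^ 3 = (M * h) * h * h := by ring
          _ ≤ 1 / 2 * h * 1 := by gcongr; linarith
          _ = h / 2 := by ring
      linarith
    have key := near_pair_ineq hs hρ hρh hab2 hq hA hB hlow hu hv huv
    have herr : ρ ^ (-s - 2) * (3 * (M * h ^ 3)) ≤ η * (ρ ^ (-s) / s) := by
      have h2 : ρ ^ (-s) = ρ ^ (-s - 2) * ρ ^ 2 := by
        rw [← Real.rpow_natCast, ← Real.rpow_add hρ]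
        congr 1
        push_cast
        ring
      have h3 : 3 * (M * h ^ 3) * s ≤ η * ρ ^ 2 := by
        have : h ^ 2 ≤ 4 * ρ ^ 2 := by nlinarith
        calc 3 * (M * h ^ 3) * s = 3 * M * h * s * h ^ 2 := by ring
          _ ≤ 3 * M * h * s * (4 * ρ ^ 2) := by gcongr
          _ = 12 * M * h * s * ρ ^ 2 := by ring
          _ ≤ η * ρ ^ 2 := by gcongr
      rw [← mul_div_assoc, le_div_iff₀ hs, h2]
      calc _ = ρ ^ (-s - 2) * (3 * (M * h ^ 3) * s) := by ring
        _ ≤ ρ ^ (-s - 2) * (η * ρ ^ 2) := by gcongr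
        _ = _ := by ring
    have hK : 0 ≤ c ^ (-s) / s + 2 * c ^ (-s - 1) := by positivity
    rw [pairGrad_eq hs.ne' hne, pairGrad_eq hs.ne' hne.symm, norm_sub_rev (x a), ← hρdef,
      ← neg_sub (x b), inner_neg_left, rieszPotential, ← hρdef]
    linarith

/-- Approximate star-convexity of the interaction energy of a pair: `u` and `v` are the
displacements of the two particles from positions at arc-length distance `q` along the curve, and
both arcs joining these positions appear on the left. -/
theorem exists_pair_bound {d : ℕ} {s : ℝ} (hs : 0 < s) {x : ℝ → EuclideanSpace ℝ (Fin d)}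
    (hx : IsUnitClosedCurve x) {η : ℝ} (hη : 0 < η) :
    ∃ K : ℝ, 0 ≤ K ∧ ∀ a b q u v : ℝ, 0 < b - a → b - a < 1 → 0 < q → q < 1 →
      |u| ≤ 1 → |v| ≤ 1 → v - u = b - a - q →
      (1 - η) * rieszPotential s (x a - x b) - (q ^ (-s) / s + (1 - q) ^ (-s) / s) - K
        ≤ pairGrad s x a b * u + pairGrad s x b a * v := by
  obtain ⟨K, hK, h⟩ := exists_half_pair_bound hs hx hη
  refine ⟨K, hK, fun a b q u v hab hab1 hq hq1 hu hv huv => ?_⟩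
  have h1q : 0 < 1 - q := by linarith
  have hq0 : 0 ≤ q ^ (-s) / s := by positivity
  have hq0' : 0 ≤ (1 - q) ^ (-s) / s := by positivity
  rcases le_total (b - a) (1 / 2) with hle | hle
  · have := h a b q u v hab hle hq hu hv huv
    rw [rieszPotential, norm_sub_rev, ← rieszPotential]
    linarith
  · have := h b (a + 1) (1 - q) v u (by linarith) (by linarith) h1q hv hu (by linarith)
    simp only [pairGrad, hx.periodic a, hx.periodic_deriv a] at this ⊢
    linarith


/-! ### Summation over pairs and approximate star-convexity of the energy -/

theorem sum_Ioi_add_swap {N : ℕ} (F : Fin N → Fin N → ℝ) :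
    ∑ i, ∑ j ∈ Finset.Ioi i, (F i j + F j i) = ∑ i, ∑ j ∈ Finset.univ.erase i, F i j := by
  rw [Finset.sum_sum_Ioi_add_eq_sum_sum_off_diag (fun j i => F i j)]
  refine Finset.sum_congr rfl fun i _ => Finset.sum_congr ?_ fun _ _ => rfl
  ext j
  simp

theorem summable_add_one_rpow_neg {s : ℝ} (hs : 1 < s) :
    Summable fun n : ℕ => ((n : ℝ) + 1) ^ (-s) := by
  have := (summable_nat_add_iff 1).2 (Real.summable_nat_rpow.2 (show -s < -1 by linarith))
  simpa using this

theorem zeta_pos {s : ℝ} (hs : 1 < s) : 0 < zeta s :=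
  (summable_add_one_rpow_neg hs).tsum_pos (fun n => by positivity) 0 (by simp)

/-- The equispaced configuration has energy at most `ζ(s) / s`, even if each pair interacts along
both arcs: the gap `k / N` or its complement occurs exactly `N` times. -/
theorem sum_equispaced_le {s : ℝ} (hs : 1 < s) {N : ℕ} (hN : 0 < N) :
    ∑ i : Fin N, ∑ j ∈ Finset.Ioi i,
      ((((j : ℝ) - i) / N) ^ (-s) + (1 - ((j : ℝ) - i) / N) ^ (-s)) ≤ (N : ℝ) ^ (s + 1) * zeta s := by
  have : NeZero N := ⟨hN.ne'⟩
  have hN' : (0 : ℝ) < N := by exact_mod_cast hN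
  set g : Fin N → ℝ := fun k => (((k : ℕ) : ℝ) / N) ^ (-s)
  have hg : ∑ k, g k ≤ (N : ℝ) ^ s * zeta s := by
    have h1 : ∀ k : Fin N, g k = (N : ℝ) ^ s * ((k : ℕ) : ℝ) ^ (-s) := fun k => by
      simp only [g]
      rw [Real.div_rpow (by positivity) hN'.le, Real.rpow_neg hN'.le, div_inv_eq_mul, mul_comm]
    simp only [h1]
    rw [← Finset.mul_sum, Fin.sum_univ_eq_sum_range (fun k => (k : ℝ) ^ (-s))]
    gcongr
    obtain ⟨M, rfl⟩ : ∃ M, N = M + 1 := ⟨N - 1, by omega⟩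
    rw [Finset.sum_range_succ', Nat.cast_zero, Real.zero_rpow (by linarith), add_zero]
    simp only [Nat.cast_add, Nat.cast_one]
    exact (summable_add_one_rpow_neg hs).sum_le_tsum _ (fun _ _ => by positivity)
  calc _ = ∑ i : Fin N, ∑ j ∈ Finset.Ioi i, (g (j - i) + g (i - j)) := by
        refine Finset.sum_congr rfl fun i _ => Finset.sum_congr rfl fun j hj => ?_
        have hij : i < j := Finset.mem_Ioi.1 hj
        simp only [g]
        rw [Fin.coe_sub_iff_le.2 hij.le, Fin.coe_sub_iff_lt.2 hij,
          Nat.cast_sub (Fin.le_def.1 hij.le), Nat.cast_sub (by omega)]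
        congr 2
        push_cast
        field_simp
        ring
    _ = ∑ i : Fin N, ∑ j ∈ Finset.univ.erase i, g (j - i) :=
        sum_Ioi_add_swap fun i j => g (j - i)
    _ ≤ ∑ i : Fin N, ∑ j, g (j - i) := by
        refine Finset.sum_le_sum fun i _ => Finset.sum_le_sum_of_subset_of_nonneg
          (Finset.erase_subset _ _) fun j _ _ => ?_
        simp only [g]
        positivity
    _ = ∑ _i : Fin N, ∑ k, g k :=
        Finset.sum_congr rfl fun i _ => Equiv.sum_comp (Equiv.subRight i) g
    _ ≤ ∑ _i : Fin N, (N : ℝ) ^ s * zeta s := Finset.sum_le_sum fun _ _ => hg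
    _ = (N : ℝ) ^ (s + 1) * zeta s := by
        rw [Finset.sum_const, Finset.card_univ, Fintype.card_fin, nsmul_eq_mul,
          Real.rpow_add_one hN'.ne']
        ring

/-- The directional derivative of the energy, `⟪∇E(Z), u⟫ = -(1 / N) ∑ u_i velocity_i(Z)`. -/
theorem sum_pairGrad_eq {d N : ℕ} (hN : 0 < N) (s : ℝ) (x : ℝ → EuclideanSpace ℝ (Fin d))
    (Z u : Fin N → ℝ) :
    (N : ℝ) ^ (-s - 1) * ∑ i, ∑ j ∈ Finset.Ioi i,
      (pairGrad s x (Z i) (Z j) * u i + pairGrad s x (Z j) (Z i) * u j)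
      = -(1 / N) * ∑ i, u i * velocity s x Z i := by
  have hN' : (N : ℝ) ≠ 0 := by exact_mod_cast hN.ne'
  rw [sum_Ioi_add_swap fun i j => pairGrad s x (Z i) (Z j) * u i, Real.rpow_sub_one hN',
    Finset.mul_sum, Finset.mul_sum]
  refine Finset.sum_congr rfl fun i _ => ?_
  rw [← Finset.sum_mul, velocity]
  simp only [pairGrad]
  ring

theorem IsOrdered.sub_pos {N : ℕ} {Z : Fin N → ℝ} (hZ : IsOrdered Z) {i j : Fin N} (h : i < j) :
    0 < Z j - Z i :=
  _root_.sub_pos.2 (hZ.1 h)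

theorem IsOrdered.sub_lt_one {N : ℕ} {Z : Fin N → ℝ} (hZ : IsOrdered Z) (i j : Fin N) :
    Z j - Z i < 1 := by
  linarith [hZ.2 j i]

/-- Approximate star-convexity of the energy with respect to the equispaced configurations, the
displacement from one of which is `u`. -/
theorem exists_star_convexity_bound {d : ℕ} {s : ℝ} (hs : 1 < s)
    {x : ℝ → EuclideanSpace ℝ (Fin d)} (hx : IsUnitClosedCurve x) {η : ℝ} (hη : 0 < η) :
    ∃ K : ℝ, 0 ≤ K ∧ ∀ (N : ℕ) (Z u : Fin N → ℝ), 0 < N → IsOrdered Z → (∀ i, |u i| ≤ 1) →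
      (∀ i j : Fin N, u j - u i = Z j - Z i - ((j : ℝ) - i) / N) →
      (1 - η) * energy s x Z - zeta s / s - K * (N : ℝ) ^ (1 - s)
        ≤ -(1 / N) * ∑ i, u i * velocity s x Z i := by
  have hs0 : 0 < s := by linarith
  obtain ⟨K, hK, hpair⟩ := exists_pair_bound hs0 hx hη
  refine ⟨K, hK, fun N Z u hN hZ hu hdiff => ?_⟩
  have hN' : (0 : ℝ) < N := by exact_mod_cast hN
  rw [← sum_pairGrad_eq hN]
  set q : Fin N → Fin N → ℝ := fun i j => ((j : ℝ) - i) / N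
  set W : Fin N → Fin N → ℝ := fun i j => rieszPotential s (x (Z i) - x (Z j))
  have hsum : ∑ i : Fin N, ∑ j ∈ Finset.Ioi i,
      ((1 - η) * W i j - (q i j ^ (-s) + (1 - q i j) ^ (-s)) / s - K) ≤
      ∑ i, ∑ j ∈ Finset.Ioi i,
        (pairGrad s x (Z i) (Z j) * u i + pairGrad s x (Z j) (Z i) * u j) := by
    refine Finset.sum_le_sum fun i _ => Finset.sum_le_sum fun j hj => ?_
    have hij : i < j := Finset.mem_Ioi.1 hj
    have h1 : ((i : ℕ) : ℝ) < (j : ℕ) := by exact_mod_cast hij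
    have h2 : ((j : ℕ) : ℝ) < N := by exact_mod_cast j.2
    have h3 : (0 : ℝ) ≤ ((i : ℕ) : ℝ) := Nat.cast_nonneg _
    rw [add_div]
    exact hpair (Z i) (Z j) (q i j) (u i) (u j) (hZ.sub_pos hij) (hZ.sub_lt_one i j)
      (div_pos (by linarith) hN') ((div_lt_one hN').2 (by linarith)) (hu i) (hu j) (hdiff i j)
  have hcount : ∑ i : Fin N, ∑ j ∈ Finset.Ioi i, K ≤ (N : ℝ) * N * K := by
    calc ∑ i : Fin N, ∑ j ∈ Finset.Ioi i, K ≤ ∑ i : Fin N, ∑ j : Fin N, K :=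
          Finset.sum_le_sum fun i _ => Finset.sum_le_sum_of_subset_of_nonneg
            (Finset.subset_univ _) fun _ _ _ => hK
      _ = (N : ℝ) * N * K := by
          simp [mul_assoc]
  have hequi := sum_equispaced_le hs hN
  have hsplit : ∑ i : Fin N, ∑ j ∈ Finset.Ioi i,
      ((1 - η) * W i j - (q i j ^ (-s) + (1 - q i j) ^ (-s)) / s - K)
      = (1 - η) * ∑ i : Fin N, ∑ j ∈ Finset.Ioi i, W i j
        - (∑ i : Fin N, ∑ j ∈ Finset.Ioi i, (q i j ^ (-s) + (1 - q i j) ^ (-s))) / s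
        - ∑ i : Fin N, ∑ j ∈ Finset.Ioi i, K := by
    simp only [Finset.sum_sub_distrib, Finset.mul_sum, Finset.sum_div]
  rw [hsplit] at hsum
  have hlow : (1 - η) * ∑ i : Fin N, ∑ j ∈ Finset.Ioi i, W i j
      - (N : ℝ) ^ (s + 1) * zeta s / s - (N : ℝ) * N * K ≤ ∑ i, ∑ j ∈ Finset.Ioi i,
        (pairGrad s x (Z i) (Z j) * u i + pairGrad s x (Z j) (Z i) * u j) := by
    have := div_le_div_of_nonneg_right hequi hs0.le
    linarith
  have hmul := mul_le_mul_of_nonneg_left hlow (by positivity : (0 : ℝ) ≤ (N : ℝ) ^ (-s - 1))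
  have e1 : (N : ℝ) ^ (-s - 1) * (N : ℝ) ^ (s + 1) = 1 := by
    rw [← Real.rpow_add hN', show -s - 1 + (s + 1) = 0 by ring, Real.rpow_zero]
  have e2 : (N : ℝ) ^ (-s - 1) * (N * N) = (N : ℝ) ^ (1 - s) := by
    rw [← mul_assoc, ← Real.rpow_add_one hN'.ne', ← Real.rpow_add_one hN'.ne']
    congr 1
    ring
  refine le_trans (le_of_eq ?_) hmul
  rw [energy, ← e2]
  have e3 : zeta s / s = (N : ℝ) ^ (-s - 1) * (N : ℝ) ^ (s + 1) * (zeta s / s) := by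
    rw [e1, one_mul]
  rw [e3]
  ring

/-! ### Dissipation of energy and preservation of the order -/

theorem hasDerivWithinAt_rieszPotential_comp {d : ℕ} {s : ℝ} (hs : s ≠ 0)
    {x : ℝ → EuclideanSpace ℝ (Fin d)} (hx : IsUnitClosedCurve x) {a b : ℝ → ℝ} {a' b' t : ℝ}
    {S : Set ℝ} (ha : HasDerivWithinAt a a' S t) (hb : HasDerivWithinAt b b' S t)
    (hab : x (a t) ≠ x (b t)) :
    HasDerivWithinAt (fun τ => rieszPotential s (x (a τ) - x (b τ)))
      (pairGrad s x (a t) (b t) * a' + pairGrad s x (b t) (a t) * b') S t := by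
  have h1 := (hasGradientAt_rieszPotential hs (sub_ne_zero.2 hab)).hasFDerivAt
  have h2 := ((hx.hasDerivAt (a t)).scomp_hasDerivWithinAt t ha).fun_sub
    ((hx.hasDerivAt (b t)).scomp_hasDerivWithinAt t hb)
  have h3 := h1.comp_hasDerivWithinAt t h2
  refine h3.congr_deriv ?_
  rw [pairGrad_eq hs hab, pairGrad_eq hs hab.symm, InnerProductSpace.toDual_apply_apply,
    norm_sub_rev (x (b t)), ← neg_sub (x (a t)) (x (b t))]
  simp only [inner_neg_left, inner_sub_right, inner_smul_left, inner_smul_right]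
  simp
  ring

theorem IsOrdered.apply_ne {d N : ℕ} {x : ℝ → EuclideanSpace ℝ (Fin d)}
    (hx : IsUnitClosedCurve x) {Z : Fin N → ℝ} (hZ : IsOrdered Z) {i j : Fin N} (h : i < j) :
    x (Z i) ≠ x (Z j) :=
  hx.apply_ne (hZ.sub_pos h) (hZ.sub_lt_one i j)

theorem IsSolution.hasDerivWithinAt_energy {d N : ℕ} (hN : 0 < N) {s : ℝ} (hs : s ≠ 0)
    {x : ℝ → EuclideanSpace ℝ (Fin d)} (hx : IsUnitClosedCurve x) {z : ℝ → Fin N → ℝ}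
    (hz : IsSolution s x z) {t : ℝ} (ht : 0 ≤ t) (hord : IsOrdered (z t)) :
    HasDerivWithinAt (fun τ => energy s x (z τ))
      (-(1 / N) * ∑ i, velocity s x (z t) i * velocity s x (z t) i) (Set.Ici 0) t := by
  rw [← sum_pairGrad_eq hN]
  refine HasDerivWithinAt.const_mul _ (HasDerivWithinAt.fun_sum fun i _ =>
    HasDerivWithinAt.fun_sum fun j hj => ?_)
  exact hasDerivWithinAt_rieszPotential_comp hs hx (hz t ht i) (hz t ht j)
    (hord.apply_ne hx (Finset.mem_Ioi.1 hj))

theorem IsSolution.antitoneOn_energy {d N : ℕ} (hN : 0 < N) {s : ℝ} (hs : s ≠ 0)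
    {x : ℝ → EuclideanSpace ℝ (Fin d)} (hx : IsUnitClosedCurve x) {z : ℝ → Fin N → ℝ}
    (hz : IsSolution s x z) {D : Set ℝ} (hD : Convex ℝ D) (hD0 : D ⊆ Set.Ici 0)
    (hord : ∀ t ∈ D, IsOrdered (z t)) :
    AntitoneOn (fun t => energy s x (z t)) D := by
  have hder : ∀ t ∈ interior D, HasDerivAt (fun t => energy s x (z t))
      (-(1 / N) * ∑ i, velocity s x (z t) i * velocity s x (z t) i) t := by
    intro t ht
    refine (hz.hasDerivWithinAt_energy hN hs hx (hD0 (interior_subset ht))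
      (hord t (interior_subset ht))).hasDerivAt ?_
    exact Filter.mem_of_superset (mem_interior_iff_mem_nhds.1 ht) hD0
  refine antitoneOn_of_deriv_nonpos hD (fun t ht => ?_)
    (fun t ht => (hder t ht).differentiableAt.differentiableWithinAt) (fun t ht => ?_)
  · exact (hz.hasDerivWithinAt_energy hN hs hx (hD0 ht) (hord t ht)).continuousWithinAt.mono hD0
  · rw [(hder t ht).deriv, neg_mul]
    exact neg_nonpos.2 (mul_nonneg (by positivity)
      (Finset.sum_nonneg fun i _ => mul_self_nonneg _))

theorem rieszPotential_nonneg {d : ℕ} {s : ℝ} (hs : 0 < s) (v : EuclideanSpace ℝ (Fin d)) :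
    0 ≤ rieszPotential s v := by
  rw [rieszPotential]
  positivity

/-- A bound on the energy separates the particles. The conclusion is written so that it passes to
limits. -/
theorem one_le_mul_norm_rpow {d N : ℕ} (hN : 0 < N) {s : ℝ} (hs : 0 < s)
    {x : ℝ → EuclideanSpace ℝ (Fin d)} {Z : Fin N → ℝ} {B : ℝ} (hB : energy s x Z ≤ B)
    {i j : Fin N} (hij : i < j) (hne : x (Z i) ≠ x (Z j)) :
    1 ≤ s * (N : ℝ) ^ (s + 1) * B * ‖x (Z i) - x (Z j)‖ ^ s := by
  have hN' : (0 : ℝ) < N := by exact_mod_cast hN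
  have hρ : 0 < ‖x (Z i) - x (Z j)‖ := norm_pos_iff.2 (sub_ne_zero.2 hne)
  have h1 : rieszPotential s (x (Z i) - x (Z j))
      ≤ ∑ i : Fin N, ∑ j ∈ Finset.Ioi i, rieszPotential s (x (Z i) - x (Z j)) :=
    (Finset.single_le_sum (f := fun j => rieszPotential s (x (Z i) - x (Z j)))
      (fun k _ => rieszPotential_nonneg hs _) (Finset.mem_Ioi.2 hij)).trans
    (Finset.single_le_sum
      (f := fun i => ∑ j ∈ Finset.Ioi i, rieszPotential s (x (Z i) - x (Z j)))
      (fun k _ => Finset.sum_nonneg fun l _ => rieszPotential_nonneg hs _) (Finset.mem_univ i))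
  have e1 : (N : ℝ) ^ (s + 1) * (N : ℝ) ^ (-s - 1) = 1 := by
    rw [← Real.rpow_add hN', show s + 1 + (-s - 1) = 0 by ring, Real.rpow_zero]
  have h2 : rieszPotential s (x (Z i) - x (Z j)) ≤ (N : ℝ) ^ (s + 1) * B := by
    have h3 := mul_le_mul_of_nonneg_left hB (by positivity : (0 : ℝ) ≤ (N : ℝ) ^ (s + 1))
    rw [energy, ← mul_assoc, e1, one_mul] at h3
    exact h1.trans h3
  rw [rieszPotential, div_le_iff₀ hs, Real.rpow_neg hρ.le,
    inv_le_iff_one_le_mul₀ (by positivity)] at h2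
  linarith

/-- Particles cannot collide, because the energy stays bounded by its initial value. -/
theorem IsSolution.isOrdered {d N : ℕ} (hN : 0 < N) {s : ℝ} (hs : 0 < s)
    {x : ℝ → EuclideanSpace ℝ (Fin d)} (hx : IsUnitClosedCurve x) {z : ℝ → Fin N → ℝ}
    (hz : IsSolution s x z) (h0 : IsOrdered (z 0)) {t : ℝ} (ht : 0 ≤ t) : IsOrdered (z t) := by
  by_contra hcon
  set S : Set ℝ := {t | 0 ≤ t ∧ ¬ IsOrdered (z t)} with hS
  have hSne : S.Nonempty := ⟨t, ht, hcon⟩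
  have hSbdd : BddBelow S := ⟨0, fun r hr => hr.1⟩
  set T := sInf S with hT
  have hT0 : 0 ≤ T := le_csInf hSne fun r hr => hr.1
  have hbefore : ∀ r ∈ Set.Ico 0 T, IsOrdered (z r) := by
    intro r hr
    by_contra h
    exact absurd (csInf_le hSbdd (show r ∈ S from ⟨hr.1, h⟩)) (not_le.2 hr.2)
  have hcont : ∀ i, ContinuousWithinAt (fun τ => z τ i) (Set.Ici 0) T := fun i =>
    (hz T hT0 i).continuousWithinAt
  have hTord : IsOrdered (z T) := by
    rcases hT0.eq_or_lt with h | hTpos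
    · rwa [← h]
    have hIco : Set.Ico 0 T ⊆ Set.Ici 0 := fun r hr => hr.1
    have : (nhdsWithin T (Set.Ico 0 T)).NeBot := by
      rw [← mem_closure_iff_nhdsWithin_neBot, closure_Ico hTpos.ne]
      exact ⟨hT0, le_rfl⟩
    have hlim : ∀ i, Filter.Tendsto (fun τ => z τ i) (nhdsWithin T (Set.Ico 0 T))
        (nhds (z T i)) := fun i => (hcont i).mono hIco
    have hanti := hz.antitoneOn_energy hN hs.ne' hx (convex_Ico 0 T) hIco hbefore
    have hne : ∀ i j, i < j → x (z T i) ≠ x (z T j) := by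
      intro i j hij heq
      have hl : Filter.Tendsto (fun τ => s * (N : ℝ) ^ (s + 1) * energy s x (z 0) *
          ‖x (z τ i) - x (z τ j)‖ ^ s) (nhdsWithin T (Set.Ico 0 T))
          (nhds (s * (N : ℝ) ^ (s + 1) * energy s x (z 0) * ‖x (z T i) - x (z T j)‖ ^ s)) := by
        have hxc := hx.contDiff.continuous
        exact (((((hxc.tendsto _).comp (hlim i)).sub ((hxc.tendsto _).comp (hlim j))).norm).rpow_const
          (Or.inr hs.le)).const_mul _
      have h1 := ge_of_tendsto (b := (1 : ℝ)) hl (by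
        filter_upwards [self_mem_nhdsWithin] with r hr
        exact one_le_mul_norm_rpow hN hs (hanti ⟨le_rfl, hTpos⟩ hr hr.1) hij
          ((hbefore r hr).apply_ne hx hij))
      rw [heq, sub_self, norm_zero, Real.zero_rpow hs.ne', mul_zero] at h1
      linarith
    have hlt : ∀ i j, i < j → z T i < z T j := by
      intro i j hij
      refine lt_of_le_of_ne (le_of_tendsto_of_tendsto (hlim i) (hlim j) ?_)
        fun h => hne i j hij (by rw [h])
      filter_upwards [self_mem_nhdsWithin] with r hr
      exact ((hbefore r hr).1 hij).le
    refine ⟨fun i j => hlt i j, fun i j => ?_⟩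
    rcases le_or_gt i j with hij | hij
    · rcases hij.eq_or_lt with rfl | hij
      · linarith
      · linarith [hlt i j hij]
    · refine lt_of_le_of_ne (le_of_tendsto_of_tendsto (hlim i) ((hlim j).add_const 1) ?_)
        fun h => hne j i hij (by rw [h, hx.periodic])
      filter_upwards [self_mem_nhdsWithin] with r hr
      exact ((hbefore r hr).2 i j).le
  have hev : ∀ᶠ r in nhdsWithin T (Set.Ici 0), IsOrdered (z r) := by
    have h1 : ∀ᶠ r in nhdsWithin T (Set.Ici 0), ∀ i j, i < j → z r i < z r j := by
      refine Filter.eventually_all.2 fun i => Filter.eventually_all.2 fun j =>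
        Filter.eventually_all.2 fun hij => ?_
      exact (hcont i).eventually_lt (hcont j) (hTord.1 hij)
    have h2 : ∀ᶠ r in nhdsWithin T (Set.Ici 0), ∀ i j, z r i < z r j + 1 := by
      refine Filter.eventually_all.2 fun i => Filter.eventually_all.2 fun j => ?_
      exact (hcont i).eventually_lt ((hcont j).add_const 1) (hTord.2 i j)
    filter_upwards [h1, h2] with r hr1 hr2
    exact ⟨fun i j => hr1 i j, hr2⟩
  obtain ⟨δ, hδ, hball⟩ := Metric.mem_nhdsWithin_iff.1 hev
  obtain ⟨r, hrS, hr⟩ := exists_lt_of_csInf_lt hSne (show sInf S < T + δ by linarith)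
  have hTr : T ≤ r := csInf_le hSbdd hrS
  refine hrS.2 (hball ⟨?_, hrS.1⟩)
  rw [Metric.mem_ball, Real.dist_eq, abs_of_nonneg (by linarith)]
  linarith

/-! ### The Lyapunov functional and the decay of the energy -/

/-- The displacement of a configuration from the equispaced configuration with the same centre of
mass. -/
noncomputable def displacement {N : ℕ} (Z : Fin N → ℝ) (i : Fin N) : ℝ :=
  Z i - (i : ℝ) / N - (1 / N) * ∑ k : Fin N, (Z k - (k : ℝ) / N)

theorem displacement_sub {N : ℕ} (Z : Fin N → ℝ) (i j : Fin N) :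
    displacement Z j - displacement Z i = Z j - Z i - ((j : ℝ) - i) / N := by
  rw [displacement, displacement]
  ring

theorem sum_displacement {N : ℕ} (hN : 0 < N) (Z : Fin N → ℝ) : ∑ i, displacement Z i = 0 := by
  have hN' : (N : ℝ) ≠ 0 := by exact_mod_cast hN.ne'
  simp only [displacement]
  rw [Finset.sum_sub_distrib (f := fun i : Fin N => Z i - (i : ℝ) / N), Finset.sum_const,
    Finset.card_univ, Fintype.card_fin, nsmul_eq_mul, ← mul_assoc, mul_one_div_cancel hN',
    one_mul, sub_self]

theorem IsOrdered.abs_displacement_le {N : ℕ} (hN : 0 < N) {Z : Fin N → ℝ} (hZ : IsOrdered Z)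
    (i : Fin N) : |displacement Z i| ≤ 1 := by
  have hN' : (0 : ℝ) < N := by exact_mod_cast hN
  have hlt : ∀ j k : Fin N, j ≤ k → |displacement Z k - displacement Z j| ≤ 1 := by
    intro j k hjk
    rw [displacement_sub]
    have h1 := hZ.sub_lt_one j k
    have h2 : 0 ≤ Z k - Z j := sub_nonneg.2 (hZ.1.monotone hjk)
    have h3 : ((j : ℕ) : ℝ) ≤ (k : ℕ) := by exact_mod_cast hjk
    have h4 : ((k : ℕ) : ℝ) < N := by exact_mod_cast k.2
    have h5 : (0 : ℝ) ≤ ((j : ℕ) : ℝ) := Nat.cast_nonneg _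
    have h6 : ((k : ℝ) - j) / N ≤ 1 := (div_le_one hN').2 (by linarith)
    have h7 : 0 ≤ ((k : ℝ) - j) / N := div_nonneg (by linarith) hN'.le
    rw [abs_le]
    constructor <;> linarith
  have hall : ∀ k : Fin N, |displacement Z i - displacement Z k| ≤ 1 := by
    intro k
    rcases le_total k i with h | h
    · exact hlt k i h
    · rw [abs_sub_comm]
      exact hlt i k h
  have hmean : N * displacement Z i = ∑ k, (displacement Z i - displacement Z k) := by
    rw [Finset.sum_sub_distrib, sum_displacement hN, Finset.sum_const, Finset.card_univ,
      Fintype.card_fin, nsmul_eq_mul, sub_zero]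
  have h1 : (N : ℝ) * |displacement Z i| ≤ N * 1 := by
    calc (N : ℝ) * |displacement Z i| = |N * displacement Z i| := by
          rw [abs_mul, abs_of_pos hN']
      _ ≤ ∑ k, |displacement Z i - displacement Z k| := by
          rw [hmean]
          exact Finset.abs_sum_le_sum_abs _ _
      _ ≤ ∑ _k : Fin N, (1 : ℝ) := Finset.sum_le_sum fun k _ => hall k
      _ = N * 1 := by simp
  exact le_of_mul_le_mul_left h1 hN'

theorem hasDerivWithinAt_lyapunov {N : ℕ} (hN : 0 < N) {z : ℝ → Fin N → ℝ} {v : Fin N → ℝ}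
    {S : Set ℝ} {t : ℝ} (hz : ∀ i, HasDerivWithinAt (fun τ => z τ i) (v i) S t) :
    HasDerivWithinAt (fun τ => 1 / (2 * N) * ∑ i, displacement (z τ) i ^ 2)
      (1 / N * ∑ i, displacement (z t) i * v i) S t := by
  have hN' : (N : ℝ) ≠ 0 := by exact_mod_cast hN.ne'
  have h1 : ∀ i, HasDerivWithinAt (fun τ => displacement (z τ) i)
      (v i - 1 / N * ∑ k, v k) S t := fun i =>
    ((hz i).sub_const _).fun_sub
      ((HasDerivWithinAt.fun_sum fun k _ => (hz k).sub_const _).const_mul _)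
  have h2 : HasDerivWithinAt (fun τ => 1 / (2 * N) * ∑ i, displacement (z τ) i ^ 2)
      (1 / (2 * N) * ∑ i, (2 : ℕ) * displacement (z t) i ^ (2 - 1) * (v i - 1 / N * ∑ k, v k))
      S t :=
    HasDerivWithinAt.const_mul _ (HasDerivWithinAt.fun_sum fun i _ => (h1 i).fun_pow 2)
  refine h2.congr_deriv ?_
  have h3 : ∑ i, (2 : ℕ) * displacement (z t) i ^ (2 - 1) * (v i - 1 / N * ∑ k, v k)
      = 2 * ∑ i, displacement (z t) i * v i
        - 2 * (1 / N * ∑ k, v k) * ∑ i, displacement (z t) i := by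
    generalize 1 / (N : ℝ) * ∑ k, v k = m
    rw [Finset.mul_sum, Finset.mul_sum, ← Finset.sum_sub_distrib]
    refine Finset.sum_congr rfl fun i _ => ?_
    push_cast
    ring
  rw [h3, sum_displacement hN]
  field_simp
  ring

/-- The analogue, for an approximately star-convex energy, of the decay rate `dist² / (2 t)` of the
gradient flow of a convex function. -/
theorem exists_energy_decay {d : ℕ} {s : ℝ} (hs : 1 < s)
    {x : ℝ → EuclideanSpace ℝ (Fin d)} (hx : IsUnitClosedCurve x) {η : ℝ} (hη : 0 < η)
    (hη1 : η ≤ 1) :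
    ∃ K : ℝ, 0 ≤ K ∧ ∀ (N : ℕ) (z : ℝ → Fin N → ℝ), 0 < N → IsOrdered (z 0) →
      IsSolution s x z → ∀ t : ℝ, 0 < t →
      (1 - η) * energy s x (z t) ≤ zeta s / s + K * (N : ℝ) ^ (1 - s) + 1 / (2 * t) := by
  have hs0 : 0 < s := by linarith
  obtain ⟨K, hK, hstar⟩ := exists_star_convexity_bound hs hx hη
  refine ⟨K, hK, fun N z hN h0 hz t ht => ?_⟩
  have hN' : (0 : ℝ) < N := by exact_mod_cast hN
  have hord : ∀ r, 0 ≤ r → IsOrdered (z r) := fun r hr => hz.isOrdered hN hs0 hx h0 hr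
  set A : ℝ := zeta s / s + K * (N : ℝ) ^ (1 - s)
  set G : ℝ → ℝ := fun τ => 1 / (2 * N) * ∑ i, displacement (z τ) i ^ 2
    + τ * ((1 - η) * energy s x (z τ) - A) with hG
  have hder : ∀ r, 0 ≤ r → ∃ G', G' ≤ 0 ∧ HasDerivWithinAt G G' (Set.Ici 0) r := by
    intro r hr
    have hE := hz.hasDerivWithinAt_energy hN hs0.ne' hx hr (hord r hr)
    have h1 := (hasDerivWithinAt_lyapunov hN (hz r hr)).fun_add
      ((hasDerivWithinAt_id r _).fun_mul ((hE.const_mul (1 - η)).sub_const A))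
    refine ⟨_, ?_, h1⟩
    have h2 := hstar N (z r) (displacement (z r)) hN (hord r hr)
      (fun i => (hord r hr).abs_displacement_le hN i) (displacement_sub (z r))
    have h3 : 0 ≤ r * ((1 - η) * (1 / N * ∑ i, velocity s x (z r) i * velocity s x (z r) i)) :=
      mul_nonneg hr (mul_nonneg (by linarith) (mul_nonneg (by positivity)
        (Finset.sum_nonneg fun i _ => mul_self_nonneg _)))
    simp only [id]
    linarith
  have hanti : AntitoneOn G (Set.Ici 0) := by
    have hint : ∀ r ∈ interior (Set.Ici (0 : ℝ)), ∃ G', G' ≤ 0 ∧ HasDerivAt G G' r := by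
      intro r hr
      obtain ⟨G', hG', h⟩ := hder r (interior_subset hr)
      exact ⟨G', hG', h.hasDerivAt (mem_interior_iff_mem_nhds.1 hr)⟩
    refine antitoneOn_of_deriv_nonpos (convex_Ici 0) (fun r hr => ?_) (fun r hr => ?_)
      (fun r hr => ?_)
    · obtain ⟨G', -, h⟩ := hder r hr
      exact h.continuousWithinAt
    · obtain ⟨G', -, h⟩ := hint r hr
      exact h.differentiableAt.differentiableWithinAt
    · obtain ⟨G', hG', h⟩ := hint r hr
      rwa [h.deriv]
  have hGt : G t ≤ G 0 := hanti (Set.mem_Ici.2 le_rfl) (Set.mem_Ici.2 ht.le) ht.le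
  have hG0 : G 0 ≤ 1 / 2 := by
    simp only [hG, zero_mul, add_zero]
    have : ∑ i, displacement (z 0) i ^ 2 ≤ N := by
      calc ∑ i, displacement (z 0) i ^ 2 ≤ ∑ _i : Fin N, (1 : ℝ) :=
            Finset.sum_le_sum fun i _ => (sq_le_one_iff_abs_le_one _).2 (h0.abs_displacement_le hN i)
        _ = N := by simp
    rw [one_div_mul_eq_div, div_le_div_iff₀ (by positivity) (by positivity)]
    linarith
  have hV : 0 ≤ 1 / (2 * (N : ℝ)) * ∑ i, displacement (z t) i ^ 2 := by positivity
  have hfin : t * ((1 - η) * energy s x (z t) - A) ≤ 1 / 2 := by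
    simp only [hG] at hGt hG0
    linarith
  rw [← sub_le_iff_le_add', le_div_iff₀ (by positivity)]
  linarith

end RieszFlow

theorem theorem2p1 {d : ℕ} (x : ℝ → EuclideanSpace ℝ (Fin d))
    (hx : RieszFlow.IsUnitClosedCurve x) (s : ℝ) (hs : 1 < s) :
    ∃ C : ℝ, 0 < C ∧ ∀ ε : ℝ, 0 < ε → ∃ N₀ : ℕ, ∀ N : ℕ, N₀ < N →
      ∀ z : ℝ → Fin N → ℝ, RieszFlow.IsOrdered (z 0) → RieszFlow.IsSolution s x z →
        ∀ t : ℝ, C / ε ≤ t →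
          RieszFlow.energy s x (z t) ≤ RieszFlow.zeta s / s * (1 + ε) := by
  set A : ℝ := RieszFlow.zeta s / s
  have hA : 0 < A := div_pos (RieszFlow.zeta_pos hs) (by linarith)
  refine ⟨2 / A, by positivity, fun ε hε => ?_⟩
  -- With this `η` one has `(1 - η) (1 + ε) = 1 + ε / 2`; the two error terms take `A ε / 4` each.
  set η : ℝ := ε / (2 * (1 + ε)) with hη
  have hη0 : 0 < η := by positivity
  have hη1 : η < 1 := by
    rw [hη, div_lt_one (by positivity)]
    linarith
  have hηε : (1 - η) * (1 + ε) = 1 + ε / 2 := by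
    rw [hη]
    field_simp
    ring
  obtain ⟨K, hK, hdecay⟩ := RieszFlow.exists_energy_decay hs hx hη0 hη1.le
  have hlim : Filter.Tendsto (fun N : ℕ => K * (N : ℝ) ^ (1 - s)) Filter.atTop (nhds 0) := by
    have h1 := (tendsto_rpow_neg_atTop (show 0 < s - 1 by linarith)).comp
      (tendsto_natCast_atTop_atTop (R := ℝ))
    have h2 := h1.const_mul K
    simpa [Function.comp_def] using h2
  obtain ⟨N₀, hN₀⟩ := Filter.eventually_atTop.1
    (hlim.eventually (ge_mem_nhds (show 0 < A * ε / 4 by positivity)))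
  refine ⟨N₀, fun N hN z h0 hz t ht => ?_⟩
  have hCε : 0 < 2 / A / ε := by positivity
  have ht0 : 0 < t := hCε.trans_le ht
  have h1 := hdecay N z (by omega) h0 hz t ht0
  have h2 := hN₀ N hN.le
  have h3 : 1 / (2 * t) ≤ A * ε / 4 := by
    calc 1 / (2 * t) ≤ 1 / (2 * (2 / A / ε)) := by gcongr
      _ = A * ε / 4 := by
        field_simp
        norm_num
  have h4 : (1 - η) * RieszFlow.energy s x (z t) ≤ (1 - η) * (A * (1 + ε)) := by
    calc _ ≤ A + A * ε / 4 + A * ε / 4 := by linarith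
      _ = A * (1 + ε / 2) := by ring
      _ = (1 - η) * (A * (1 + ε)) := by rw [← hηε]; ring
  exact le_of_mul_le_mul_left h4 (by linarith)
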